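/- Let $\Bbbk$ be a commutative ring and let $R$ be an associative $\Bbbk$-algebra that is noetherian (on both sides). $R$-modules are left modules and $R^\circ$-modules are right $R$-modules. For an $R$-module $N$ let $0\to N\to I^0\to I^1\to\cdots$ be an injective resolution, and let $\Omega^kN=\operatorname{Ker}(I^k\to I^{k+1})$ be its $k$-th cosyzygy. The right satellites of an additive covariant functor $T$ from $R$-modules to $\Bbbk$-modules are the functors $S^0T=T$ and, for $k\ge 1$, $S^kT(N)=\operatorname{Coker}\bigl(T(I^{k-1})\to T(\Omega^kN)\bigr)$. If $\{T_i\}_{i\in\mathbb Z}$ is a homological functor (additive functors, with natural connecting maps and a long exact sequence for every short exact sequence of $R$-modules), then the connecting maps $T_{k+i}(\Omega^kN)\to T_{k-1+i}(\Omega^{k-1}N)$ of the sequences $0\to\Omega^{k-1}N\to I^{k-1}\to\Omega^kN\to 0$ induce maps $S^kT_{k+i}(N)\to S^{k-1}T_{k-1+i}(N)$, and the J-completion of $\{T_i\}$ is the family of functors $$\check T_i(N)=\lim_{k\ge 0}S^kT_{k+i}(N),\qquad i\in\mathbb Z .$$ For an $R^\circ$-module $M$, the complete homology $\check{\mathrm{Tor}}{}^R_i(M,-)$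 is the J-completion of the homological functor $\{\mathrm{Tor}^R_i(M,-)\}_{i\in\mathbb Z}$, where $\mathrm{Tor}_i=0$ for $i<0$. An acyclic complex $T$ of projective $R^\circ$-modules is totally acyclic if $\operatorname{Hom}_{R^\circ}(T,Q)$ is acyclic for every projective $R^\circ$-module $Q$. A complete projective resolution of an $R^\circ$-module $M$ is a diagram $T\xrightarrow{\varpi}P\to M$ where $T$ is a totally acyclic complex of projective $R^\circ$-modules, $P\to M$ is a projective resolution, and $\varpi_i$ is an isomorphism for all $i\gg 0$. The Tate homology of $M$ is $\widehat{\mathrm{Tor}}{}^R_i(M,N)=H_i(T\otimes_RN)$ for $i\in\mathbb Z$. **Proposition.** Let $M$ be a finitely generated $R^\circ$-module that has a complete projective resolution. For every complete projective resolution $T\to P\to M$ of $M$ and for every $i\in\mathbb Z$ there is an isomorphism of functors from the category of $R$-modules to the category of $\Bbbk$-modules, $$\check{\mathrm{Tor}}{}^R_i(M,-)\;\cong\;\widehat{\mathrm{Tor}}{}^R_i(M,-).$$ -/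

import Mathlib

open CategoryTheory CategoryTheory.Limits
open scoped TensorProduct

universe w u

namespace CompleteHomology

section BalancedTensor

set_option linter.unusedSectionVars false

/-! The tensor product `M ⊗_R N` of a right module and a left module over a
(noncommutative) `𝕜`-algebra `R`, as a `𝕜`-module. -/

variable (𝕜 : Type w) (R : Type u) [CommRing 𝕜] [Ring R] [Algebra 𝕜 R]

/-- The `𝕜`-submodule of `M ⊗_𝕜 N` spanned by all `(m r) ⊗ n - m ⊗ (r n)`. -/
def balancedRel (M N : Type u) [AddCommGroup M] [AddCommGroup N]
    [Module Rᵐᵒᵖ M] [Module R N] [Module 𝕜 M] [Module 𝕜 N] : Submodule 𝕜 (M ⊗[𝕜] N) :=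
  Submodule.span 𝕜
    {t | ∃ (m : M) (r : R) (n : N), t = (MulOpposite.op r • m) ⊗ₜ[𝕜] n - m ⊗ₜ[𝕜] (r • n)}

/-- `M ⊗_R N` for a right `R`-module `M` and a left `R`-module `N`. -/
abbrev BalancedTensor (M N : Type u) [AddCommGroup M] [AddCommGroup N]
    [Module Rᵐᵒᵖ M] [Module R N] [Module 𝕜 M] [Module 𝕜 N] : Type u :=
  (M ⊗[𝕜] N) ⧸ balancedRel 𝕜 R M N

variable {M M' M'' N N' N'' : Type u}
  [AddCommGroup M] [AddCommGroup M'] [AddCommGroup M'']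
  [AddCommGroup N] [AddCommGroup N'] [AddCommGroup N'']
  [Module Rᵐᵒᵖ M] [Module Rᵐᵒᵖ M'] [Module Rᵐᵒᵖ M''] [Module R N] [Module R N'] [Module R N'']
  [Module 𝕜 M] [Module 𝕜 M'] [Module 𝕜 M''] [Module 𝕜 N] [Module 𝕜 N'] [Module 𝕜 N'']
  [IsScalarTower 𝕜 Rᵐᵒᵖ M] [IsScalarTower 𝕜 Rᵐᵒᵖ M'] [IsScalarTower 𝕜 Rᵐᵒᵖ M'']
  [IsScalarTower 𝕜 R N] [IsScalarTower 𝕜 R N'] [IsScalarTower 𝕜 R N'']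

/-- The class of `m ⊗ n` in `M ⊗_R N`. -/
def bt (m : M) (n : N) : BalancedTensor 𝕜 R M N :=
  (balancedRel 𝕜 R M N).mkQ (m ⊗ₜ[𝕜] n)

lemma bt_balanced (m : M) (r : R) (n : N) :
    bt 𝕜 R (MulOpposite.op r • m) n = bt 𝕜 R m (r • n) := by
  rw [bt, bt, ← sub_eq_zero, ← map_sub]
  exact (Submodule.Quotient.mk_eq_zero _).2 (Submodule.subset_span ⟨m, r, n, rfl⟩)

/-- The map on `M ⊗_R N` induced by a balanced bilinear map. -/
def btLift {X : Type u} [AddCommGroup X] [Module 𝕜 X] (f : M →ₗ[𝕜] N →ₗ[𝕜] X)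
    (hf : ∀ (m : M) (r : R) (n : N), f (MulOpposite.op r • m) n = f m (r • n)) :
    BalancedTensor 𝕜 R M N →ₗ[𝕜] X :=
  (balancedRel 𝕜 R M N).liftQ (TensorProduct.lift f) (by
    rw [balancedRel, Submodule.span_le]
    rintro _ ⟨m, r, n, rfl⟩
    rw [SetLike.mem_coe, LinearMap.mem_ker, map_sub, TensorProduct.lift.tmul,
      TensorProduct.lift.tmul, sub_eq_zero, hf])

lemma btLift_bt {X : Type u} [AddCommGroup X] [Module 𝕜 X] (f : M →ₗ[𝕜] N →ₗ[𝕜] X)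
    (hf : ∀ (m : M) (r : R) (n : N), f (MulOpposite.op r • m) n = f m (r • n)) (m : M) (n : N) :
    btLift 𝕜 R f hf (bt 𝕜 R m n) = f m n := rfl

/-- The map `f ⊗_R g`. -/
def btMap (f : M →ₗ[Rᵐᵒᵖ] M') (g : N →ₗ[R] N') :
    BalancedTensor 𝕜 R M N →ₗ[𝕜] BalancedTensor 𝕜 R M' N' :=
  Submodule.mapQ _ _ (TensorProduct.map (f.restrictScalars 𝕜) (g.restrictScalars 𝕜)) (by
    rw [balancedRel, Submodule.span_le]
    rintro _ ⟨m, r, n, rfl⟩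
    refine Submodule.subset_span ⟨f m, r, g n, ?_⟩
    simp)

@[simp]
lemma btMap_bt (f : M →ₗ[Rᵐᵒᵖ] M') (g : N →ₗ[R] N') (m : M) (n : N) :
    btMap 𝕜 R f g (bt 𝕜 R m n) = bt 𝕜 R (f m) (g n) := rfl


variable {𝕜 R} in
@[elab_as_elim]
lemma bt_induction {motive : BalancedTensor 𝕜 R M N → Prop} (x : BalancedTensor 𝕜 R M N)
    (zero : motive 0) (tmul : ∀ m n, motive (bt 𝕜 R m n))
    (add : ∀ x y, motive x → motive y → motive (x + y)) : motive x := by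
  obtain ⟨t, rfl⟩ := Submodule.mkQ_surjective _ x
  induction t using TensorProduct.induction_on with
  | zero => simpa using zero
  | tmul m n => exact tmul m n
  | add a b ha hb => rw [map_add]; exact add _ _ ha hb

variable {𝕜 R} in
lemma bt_hom_ext {X : Type u} [AddCommGroup X] [Module 𝕜 X]
    {f g : BalancedTensor 𝕜 R M N →ₗ[𝕜] X}
    (h : ∀ m n, f (bt 𝕜 R m n) = g (bt 𝕜 R m n)) : f = g := by
  refine LinearMap.ext fun x => ?_
  induction x using bt_induction with
  | zero => simp
  | tmul m n => exact h m n
  | add a b ha hb => rw [map_add, map_add, ha, hb]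

lemma bt_add (m : M) (n n' : N) : bt 𝕜 R m (n + n') = bt 𝕜 R m n + bt 𝕜 R m n' := by
  simp [bt, TensorProduct.tmul_add]

lemma add_bt (m m' : M) (n : N) : bt 𝕜 R (m + m') n = bt 𝕜 R m n + bt 𝕜 R m' n := by
  simp [bt, TensorProduct.add_tmul]

lemma smul_bt (a : 𝕜) (m : M) (n : N) : bt 𝕜 R (a • m) n = a • bt 𝕜 R m n := by
  rw [bt, bt, ← TensorProduct.smul_tmul', map_smul]

lemma bt_smul (a : 𝕜) (m : M) (n : N) : bt 𝕜 R m (a • n) = a • bt 𝕜 R m n := by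
  simp [bt]

lemma bt_zero (m : M) : bt 𝕜 R m (0 : N) = 0 := by
  simp [bt]

lemma zero_bt (n : N) : bt 𝕜 R (0 : M) n = 0 := by
  simp [bt]

lemma btMap_id : btMap 𝕜 R (LinearMap.id : M →ₗ[Rᵐᵒᵖ] M) (LinearMap.id : N →ₗ[R] N) =
    LinearMap.id :=
  bt_hom_ext fun _ _ => rfl

lemma btMap_comp (f : M →ₗ[Rᵐᵒᵖ] M') (f' : M' →ₗ[Rᵐᵒᵖ] M'') (g : N →ₗ[R] N')
    (g' : N' →ₗ[R] N'') :
    btMap 𝕜 R (f' ∘ₗ f) (g' ∘ₗ g) = btMap 𝕜 R f' g' ∘ₗ btMap 𝕜 R f g :=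
  bt_hom_ext fun _ _ => rfl

lemma btMap_comp_apply (f : M →ₗ[Rᵐᵒᵖ] M') (f' : M' →ₗ[Rᵐᵒᵖ] M'') (g : N →ₗ[R] N')
    (g' : N' →ₗ[R] N'') (x : BalancedTensor 𝕜 R M N) :
    btMap 𝕜 R f' g' (btMap 𝕜 R f g x) = btMap 𝕜 R (f' ∘ₗ f) (g' ∘ₗ g) x := by
  rw [btMap_comp]; rfl

lemma btMap_add_left (f f' : M →ₗ[Rᵐᵒᵖ] M') (g : N →ₗ[R] N') :
    btMap 𝕜 R (f + f') g = btMap 𝕜 R f g + btMap 𝕜 R f' g :=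
  bt_hom_ext fun _ _ => by simp [add_bt]

lemma btMap_add_right (f : M →ₗ[Rᵐᵒᵖ] M') (g g' : N →ₗ[R] N') :
    btMap 𝕜 R f (g + g') = btMap 𝕜 R f g + btMap 𝕜 R f g' :=
  bt_hom_ext fun _ _ => by simp [bt_add]

/-! Tensoring with a projective module is exact. -/

/-- The bilinear map `R^(ι) × N → N^(ι)`. -/
noncomputable def freeBilin (ι : Type u) (N : Type u) [AddCommGroup N] [Module R N] [Module 𝕜 N]
    [IsScalarTower 𝕜 R N] : (ι →₀ Rᵐᵒᵖ) →ₗ[𝕜] N →ₗ[𝕜] (ι →₀ N) :=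
  LinearMap.mk₂ 𝕜
    (fun (q : ι →₀ Rᵐᵒᵖ) (n : N) => q.mapRange (fun a => a.unop • n) (zero_smul R n))
    (fun q q' n => by ext i; simp [add_smul])
    (fun c q n => by ext i; simp)
    (fun q n n' => by ext i; simp)
    (fun c q n => by
      ext i
      simp only [Finsupp.mapRange_apply, Finsupp.smul_apply]
      exact smul_algebra_smul_comm c (q i).unop n)

lemma freeBilin_apply (ι : Type u) (q : ι →₀ Rᵐᵒᵖ) (n : N) (i : ι) :
    freeBilin 𝕜 R ι N q n i = (q i).unop • n := rfl

/-- The map `R^(ι) ⊗_R N → N^(ι)`. -/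
noncomputable def freeTo (ι : Type u) (N : Type u) [AddCommGroup N] [Module R N] [Module 𝕜 N]
    [IsScalarTower 𝕜 R N] : BalancedTensor 𝕜 R (ι →₀ Rᵐᵒᵖ) N →ₗ[𝕜] (ι →₀ N) :=
  btLift 𝕜 R (freeBilin 𝕜 R ι N) fun m r n => by
    ext i
    rw [freeBilin_apply, freeBilin_apply, ← mul_smul]
    rfl

/-- The map `N^(ι) → R^(ι) ⊗_R N`. -/
noncomputable def freeFrom (ι : Type u) (N : Type u) [AddCommGroup N] [Module R N] [Module 𝕜 N]
    [IsScalarTower 𝕜 R N] : (ι →₀ N) →ₗ[𝕜] BalancedTensor 𝕜 R (ι →₀ Rᵐᵒᵖ) N :=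
  Finsupp.lsum 𝕜 fun i =>
    { toFun := fun n => bt 𝕜 R (Finsupp.single i (1 : Rᵐᵒᵖ)) n
      map_add' := fun _ _ => bt_add ..
      map_smul' := fun _ _ => bt_smul .. }

lemma freeFrom_single (ι : Type u) (i : ι) (n : N) :
    freeFrom 𝕜 R ι N (Finsupp.single i n) = bt 𝕜 R (Finsupp.single i (1 : Rᵐᵒᵖ)) n := by
  rw [freeFrom, Finsupp.lsum_single]
  rfl

lemma freeTo_bt_single (ι : Type u) (i : ι) (a : Rᵐᵒᵖ) (n : N) :
    freeTo 𝕜 R ι N (bt 𝕜 R (Finsupp.single i a) n) = Finsupp.single i (a.unop • n) := by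
  rw [freeTo, btLift_bt]
  exact Finsupp.mapRange_single (hf := zero_smul R n)

lemma freeFrom_freeTo (ι : Type u) (x : BalancedTensor 𝕜 R (ι →₀ Rᵐᵒᵖ) N) :
    freeFrom 𝕜 R ι N (freeTo 𝕜 R ι N x) = x := by
  induction x using bt_induction with
  | zero => simp
  | add a b ha hb => rw [map_add, map_add, ha, hb]
  | tmul q n =>
    induction q using Finsupp.induction_linear with
    | zero => simp [zero_bt]
    | add q q' h h' => rw [add_bt, map_add, map_add, h, h']
    | single i a =>
      rw [freeTo_bt_single, freeFrom_single, ← bt_balanced]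
      simp

lemma freeTo_btMap (ι : Type u) (g : N →ₗ[R] N') (x : BalancedTensor 𝕜 R (ι →₀ Rᵐᵒᵖ) N) :
    freeTo 𝕜 R ι N' (btMap 𝕜 R LinearMap.id g x) =
      Finsupp.mapRange g (map_zero g) (freeTo 𝕜 R ι N x) := by
  induction x using bt_induction with
  | zero => simp
  | add a b ha hb => simp only [map_add, ha, hb, Finsupp.mapRange_add (map_add g)]
  | tmul q n =>
    induction q using Finsupp.induction_linear with
    | zero => simp [zero_bt]
    | add q q' h h' => simp only [add_bt, map_add, h, h', Finsupp.mapRange_add (map_add g)]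
    | single i a => simp [freeTo_bt_single]

lemma freeFrom_mapRange (ι : Type u) (g : N →ₗ[R] N') (x : ι →₀ N) :
    freeFrom 𝕜 R ι N' (Finsupp.mapRange g (map_zero g) x) =
      btMap 𝕜 R LinearMap.id g (freeFrom 𝕜 R ι N x) := by
  induction x using Finsupp.induction_linear with
  | zero => simp
  | add a b ha hb => simp only [map_add, ha, hb, Finsupp.mapRange_add (map_add g)]
  | single i a =>
    rw [Finsupp.mapRange_single, freeFrom_single, freeFrom_single, btMap_bt]
    rfl

variable {𝕜 R}

lemma btMap_surjective (P : Type u) [AddCommGroup P] [Module Rᵐᵒᵖ P] [Module 𝕜 P]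
    [IsScalarTower 𝕜 Rᵐᵒᵖ P] {g : N →ₗ[R] N''} (hg : Function.Surjective g) :
    Function.Surjective (btMap 𝕜 R (LinearMap.id : P →ₗ[Rᵐᵒᵖ] P) g) := by
  intro y
  induction y using bt_induction with
  | zero => exact ⟨0, map_zero _⟩
  | tmul p n => obtain ⟨n, rfl⟩ := hg n; exact ⟨bt 𝕜 R p n, rfl⟩
  | add a b ha hb =>
    obtain ⟨a, rfl⟩ := ha
    obtain ⟨b, rfl⟩ := hb
    exact ⟨a + b, map_add _ _ _⟩

lemma btMap_free_injective (ι : Type u) {f : N' →ₗ[R] N} (hf : Function.Injective f) :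
    Function.Injective (btMap 𝕜 R (LinearMap.id : (ι →₀ Rᵐᵒᵖ) →ₗ[Rᵐᵒᵖ] _) f) := by
  intro x y h
  have h' := congrArg (freeTo 𝕜 R ι N) h
  rw [freeTo_btMap, freeTo_btMap] at h'
  rw [← freeFrom_freeTo 𝕜 R ι x, Finsupp.mapRange_injective f (map_zero f) hf h',
    freeFrom_freeTo]

lemma btMap_free_exact (ι : Type u) {f : N' →ₗ[R] N} {g : N →ₗ[R] N''}
    (h : Function.Exact f g) (x : BalancedTensor 𝕜 R (ι →₀ Rᵐᵒᵖ) N)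
    (hx : btMap 𝕜 R LinearMap.id g x = 0) : ∃ y, btMap 𝕜 R LinearMap.id f y = x := by
  have h' := freeTo_btMap 𝕜 R ι g x
  rw [hx, map_zero] at h'
  have hz : ∃ z : ι →₀ N', Finsupp.mapRange f (map_zero f) z = freeTo 𝕜 R ι N x := by
    have : ∀ i, ∃ z : N', f z = freeTo 𝕜 R ι N x i ∧ (freeTo 𝕜 R ι N x i = 0 → z = 0) := by
      intro i
      by_cases h0 : freeTo 𝕜 R ι N x i = 0
      · exact ⟨0, by simp [h0], fun _ => rfl⟩
      · obtain ⟨z, hz⟩ := (h (freeTo 𝕜 R ι N x i)).1 (by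
          simpa using (DFunLike.congr_fun h' i).symm)
        exact ⟨z, hz, fun h1 => absurd h1 h0⟩
    choose z hz hz0 using this
    refine ⟨Finsupp.onFinset (freeTo 𝕜 R ι N x).support z fun i hi => ?_, ?_⟩
    · rw [Finsupp.mem_support_iff]
      exact fun h0 => hi (hz0 i h0)
    · ext i
      simp [hz]
  obtain ⟨z, hz⟩ := hz
  refine ⟨freeFrom 𝕜 R ι N' z, ?_⟩
  rw [← freeFrom_mapRange, hz, freeFrom_freeTo]

lemma btMap_projective_injective (P : Type u) [AddCommGroup P] [Module Rᵐᵒᵖ P] [Module 𝕜 P]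
    [IsScalarTower 𝕜 Rᵐᵒᵖ P] [Module.Projective Rᵐᵒᵖ P] {f : N' →ₗ[R] N}
    (hf : Function.Injective f) :
    Function.Injective (btMap 𝕜 R (LinearMap.id : P →ₗ[Rᵐᵒᵖ] P) f) := by
  obtain ⟨s, hs⟩ := Module.projective_def'.1 (inferInstance : Module.Projective Rᵐᵒᵖ P)
  intro x y hxy
  have h1 : btMap 𝕜 R s LinearMap.id x = btMap 𝕜 R s LinearMap.id y := by
    apply btMap_free_injective P hf
    have := congrArg (btMap 𝕜 R s LinearMap.id) hxy
    rw [btMap_comp_apply, btMap_comp_apply] at this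
    rw [btMap_comp_apply, btMap_comp_apply]
    exact this
  have h2 := congrArg (btMap 𝕜 R (Finsupp.linearCombination Rᵐᵒᵖ id) LinearMap.id) h1
  rw [btMap_comp_apply, btMap_comp_apply, hs, LinearMap.comp_id, btMap_id] at h2
  exact h2

lemma btMap_projective_exact (P : Type u) [AddCommGroup P] [Module Rᵐᵒᵖ P] [Module 𝕜 P]
    [IsScalarTower 𝕜 Rᵐᵒᵖ P] [Module.Projective Rᵐᵒᵖ P] {f : N' →ₗ[R] N} {g : N →ₗ[R] N''}
    (h : Function.Exact f g) :
    Function.Exact (btMap 𝕜 R (LinearMap.id : P →ₗ[Rᵐᵒᵖ] P) f)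
      (btMap 𝕜 R (LinearMap.id : P →ₗ[Rᵐᵒᵖ] P) g) := by
  obtain ⟨s, hs⟩ := Module.projective_def'.1 (inferInstance : Module.Projective Rᵐᵒᵖ P)
  intro x
  constructor
  · intro hx
    obtain ⟨y, hy⟩ := btMap_free_exact P h (btMap 𝕜 R s LinearMap.id x) (by
      have := congrArg (btMap 𝕜 R s LinearMap.id) hx
      rw [btMap_comp_apply, map_zero] at this
      rw [btMap_comp_apply]
      exact this)
    refine ⟨btMap 𝕜 R (Finsupp.linearCombination Rᵐᵒᵖ id) LinearMap.id y, ?_⟩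
    have h2 := congrArg (btMap 𝕜 R (Finsupp.linearCombination Rᵐᵒᵖ id) LinearMap.id) hy
    rw [btMap_comp_apply, btMap_comp_apply, hs, LinearMap.comp_id] at h2
    rw [btMap_comp_apply]
    exact h2.trans (LinearMap.congr_fun (btMap_id 𝕜 R) x)
  · rintro ⟨y, rfl⟩
    rw [btMap_comp_apply, h.linearMap_comp_eq_zero]
    induction y using bt_induction with
    | zero => simp
    | tmul p n => simp [bt_zero]
    | add a b ha hb => rw [map_add, ha, hb, add_zero]

end BalancedTensor

section Functors

/-- A module over a `𝕜`-algebra is a `𝕜`-module. -/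
abbrev baseModule (𝕜 : Type w) [CommRing 𝕜] {A : Type u} [Ring A] [Algebra 𝕜 A]
    (M : ModuleCat.{u} A) : Module 𝕜 M :=
  Module.restrictScalars 𝕜 A M

lemma baseModule_isScalarTower (𝕜 : Type w) [CommRing 𝕜] {A : Type u} [Ring A] [Algebra 𝕜 A]
    (M : ModuleCat.{u} A) : letI := baseModule 𝕜 M; IsScalarTower 𝕜 A M :=
  IsScalarTower.restrictScalars 𝕜 A M

variable (𝕜 : Type w) [CommRing 𝕜] {R : Type u} [Ring R] [Algebra 𝕜 R]

section

attribute [local instance] baseModule baseModule_isScalarTower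

/-- `M ⊗_R N` as an object of the category of `𝕜`-modules; `𝕜` acts on `M` and `N` through `R`. -/
noncomputable def tensorObj (M : ModuleCat.{u} Rᵐᵒᵖ) (N : ModuleCat.{u} R) : ModuleCat.{u} 𝕜 :=
  ModuleCat.of 𝕜 (BalancedTensor 𝕜 R M N)

/-- The morphism `f ⊗_R g`. -/
noncomputable def tensorMap {M M' : ModuleCat.{u} Rᵐᵒᵖ} {N N' : ModuleCat.{u} R}
    (f : M ⟶ M') (g : N ⟶ N') : tensorObj 𝕜 M N ⟶ tensorObj 𝕜 M' N' :=
  ModuleCat.ofHom (btMap 𝕜 R f.hom g.hom)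

lemma tensorMap_id (M : ModuleCat.{u} Rᵐᵒᵖ) (N : ModuleCat.{u} R) :
    tensorMap 𝕜 (𝟙 M) (𝟙 N) = 𝟙 (tensorObj 𝕜 M N) :=
  ModuleCat.hom_ext (btMap_id 𝕜 R)

lemma tensorMap_comp {M M' M'' : ModuleCat.{u} Rᵐᵒᵖ} {N N' N'' : ModuleCat.{u} R}
    (f : M ⟶ M') (f' : M' ⟶ M'') (g : N ⟶ N') (g' : N' ⟶ N'') :
    tensorMap 𝕜 (f ≫ f') (g ≫ g') = tensorMap 𝕜 f g ≫ tensorMap 𝕜 f' g' :=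
  ModuleCat.hom_ext (btMap_comp 𝕜 R f.hom f'.hom g.hom g'.hom)

lemma tensorMap_add_left {M M' : ModuleCat.{u} Rᵐᵒᵖ} {N N' : ModuleCat.{u} R}
    (f f' : M ⟶ M') (g : N ⟶ N') :
    tensorMap 𝕜 (f + f') g = tensorMap 𝕜 f g + tensorMap 𝕜 f' g :=
  ModuleCat.hom_ext (btMap_add_left 𝕜 R f.hom f'.hom g.hom)

lemma tensorMap_add_right {M M' : ModuleCat.{u} Rᵐᵒᵖ} {N N' : ModuleCat.{u} R}
    (f : M ⟶ M') (g g' : N ⟶ N') :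
    tensorMap 𝕜 f (g + g') = tensorMap 𝕜 f g + tensorMap 𝕜 f g' :=
  ModuleCat.hom_ext (btMap_add_right 𝕜 R f.hom g.hom g'.hom)

/-- The functor `N ↦ (M ↦ M ⊗_R N)`. -/
@[simps]
noncomputable def tensorFunctor : ModuleCat.{u} R ⥤ ModuleCat.{u} Rᵐᵒᵖ ⥤ ModuleCat.{u} 𝕜 where
  obj N :=
    { obj := fun M => tensorObj 𝕜 M N
      map := fun f => tensorMap 𝕜 f (𝟙 N)
      map_id := fun M => tensorMap_id 𝕜 M N
      map_comp := fun f g => by rw [← tensorMap_comp, Category.comp_id] }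
  map g :=
    { app := fun M => tensorMap 𝕜 (𝟙 M) g
      naturality := fun M M' f => by
        simp only [← tensorMap_comp, Category.id_comp, Category.comp_id] }
  map_id N := by
    ext1; funext M; exact tensorMap_id 𝕜 M N
  map_comp f g := by
    ext1; funext M
    exact (congrArg (fun h => tensorMap 𝕜 h (f ≫ g)) (Category.comp_id (𝟙 M)).symm).trans
      (tensorMap_comp 𝕜 (𝟙 M) (𝟙 M) f g)

instance (N : ModuleCat.{u} R) : ((tensorFunctor 𝕜).obj N).Additive where
  map_add := tensorMap_add_left 𝕜 _ _ _

instance (M : ModuleCat.{u} Rᵐᵒᵖ) : ((tensorFunctor 𝕜 (R := R)).flip.obj M).Additive where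
  map_add := tensorMap_add_right 𝕜 _ _ _

lemma tensor_shortExact (P : ModuleCat.{u} Rᵐᵒᵖ) [Projective P]
    {S : ShortComplex (ModuleCat.{u} R)} (hS : S.ShortExact) :
    (S.map ((tensorFunctor 𝕜).flip.obj P)).ShortExact := by
  have hP : Module.Projective Rᵐᵒᵖ P := (IsProjective.iff_projective P).2 inferInstance
  have hmono := hS.mono_f
  have hepi := hS.epi_g
  refine ShortComplex.ShortExact.mk' ?_ ?_ ?_
  · rw [ShortComplex.ShortExact.moduleCat_exact_iff_function_exact]
    exact btMap_projective_exact P 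
      ((ShortComplex.ShortExact.moduleCat_exact_iff_function_exact S).1 hS.exact)
  · exact (ModuleCat.mono_iff_injective _).2
      (btMap_projective_injective P ((ModuleCat.mono_iff_injective S.f).1 hmono))
  · exact (ModuleCat.epi_iff_surjective _).2
      (btMap_surjective P ((ModuleCat.epi_iff_surjective S.g).1 hepi))

end

/-- For a complex `K` of right `R`-modules, the functor `N ↦ K ⊗_R N`. -/
noncomputable def tensorComplex (K : ChainComplex (ModuleCat.{u} Rᵐᵒᵖ) ℤ) :
    ModuleCat.{u} R ⥤ ChainComplex (ModuleCat.{u} 𝕜) ℤ where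
  obj N := (((tensorFunctor 𝕜).obj N).mapHomologicalComplex _).obj K
  map g := (NatTrans.mapHomologicalComplex ((tensorFunctor 𝕜).map g) _).app K
  map_id N := by
    ext i : 1
    exact congrArg (fun t => t.app (K.X i)) ((tensorFunctor 𝕜).map_id N)
  map_comp f g := by
    ext i : 1
    exact congrArg (fun t => t.app (K.X i)) ((tensorFunctor 𝕜).map_comp f g)

instance (K : ChainComplex (ModuleCat.{u} Rᵐᵒᵖ) ℤ) : (tensorComplex 𝕜 (R := R) K).Additive where
  map_add := by
    intros
    ext i : 1
    exact tensorMap_add_right 𝕜 _ _ _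

lemma tensorComplex_shortExact (K : ChainComplex (ModuleCat.{u} Rᵐᵒᵖ) ℤ)
    (hK : ∀ i, Projective (K.X i)) {S : ShortComplex (ModuleCat.{u} R)} (hS : S.ShortExact) :
    (S.map (tensorComplex 𝕜 K)).ShortExact :=
  HomologicalComplex.shortExact_of_degreewise_shortExact _ fun i =>
    have := hK i
    tensor_shortExact 𝕜 (K.X i) hS

/-- A homological functor: a `ℤ`-indexed family of additive functors with natural connecting
homomorphisms that make a long exact sequence out of every short exact sequence. -/
structure HomologicalFunctor (R : Type u) [Ring R] where
  /-- the functors -/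
  F : ℤ → ModuleCat.{u} R ⥤ ModuleCat.{u} 𝕜
  additive : ∀ i, (F i).Additive
  /-- the connecting homomorphisms -/
  δ : ∀ (S : ShortComplex (ModuleCat.{u} R)) (_ : S.ShortExact) (i j : ℤ) (_ : j + 1 = i),
    (F i).obj S.X₃ ⟶ (F j).obj S.X₁
  δ_naturality : ∀ {S S' : ShortComplex (ModuleCat.{u} R)} (φ : S ⟶ S') (hS : S.ShortExact)
    (hS' : S'.ShortExact) (i j : ℤ) (h : j + 1 = i),
    δ S hS i j h ≫ (F j).map φ.τ₁ = (F i).map φ.τ₃ ≫ δ S' hS' i j h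
  exact₁ : ∀ (S : ShortComplex (ModuleCat.{u} R)) (hS : S.ShortExact) (i j : ℤ) (h : j + 1 = i),
    Function.Exact (δ S hS i j h).hom ((F j).map S.f).hom
  exact₂ : ∀ (S : ShortComplex (ModuleCat.{u} R)) (_ : S.ShortExact) (i : ℤ),
    Function.Exact ((F i).map S.f).hom ((F i).map S.g).hom
  exact₃ : ∀ (S : ShortComplex (ModuleCat.{u} R)) (hS : S.ShortExact) (i j : ℤ) (h : j + 1 = i),
    Function.Exact ((F i).map S.g).hom (δ S hS i j h).hom

/-- For a complex `K` of projective right `R`-modules, the homological functor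
`N ↦ H_i(K ⊗_R N)`, with the connecting homomorphisms given by the snake lemma. -/
noncomputable def homologyTensor (K : ChainComplex (ModuleCat.{u} Rᵐᵒᵖ) ℤ)
    (hK : ∀ i, Projective (K.X i)) : HomologicalFunctor 𝕜 R where
  F i := tensorComplex 𝕜 K ⋙ HomologicalComplex.homologyFunctor _ _ i
  additive _ := inferInstance
  δ _ hS i j h := (tensorComplex_shortExact 𝕜 K hK hS).δ i j h
  δ_naturality φ hS hS' i j h :=
    HomologicalComplex.HomologySequence.δ_naturality
      ((tensorComplex 𝕜 K).mapShortComplex.map φ) (tensorComplex_shortExact 𝕜 K hK hS)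
      (tensorComplex_shortExact 𝕜 K hK hS') i j h
  exact₁ _ hS i j h := (ShortComplex.ShortExact.moduleCat_exact_iff_function_exact _).1
    ((tensorComplex_shortExact 𝕜 K hK hS).homology_exact₁ i j h)
  exact₂ _ hS i := (ShortComplex.ShortExact.moduleCat_exact_iff_function_exact _).1
    ((tensorComplex_shortExact 𝕜 K hK hS).homology_exact₂ i)
  exact₃ _ hS i j h := (ShortComplex.ShortExact.moduleCat_exact_iff_function_exact _).1
    ((tensorComplex_shortExact 𝕜 K hK hS).homology_exact₃ i j h)

/-- The inclusion of the natural numbers in the integers, as homological degrees. -/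
@[simps!]
def degreeEmbedding : (ComplexShape.down ℕ).Embedding (ComplexShape.down ℤ) :=
  ComplexShape.Embedding.mk' _ _ (fun n => (n : ℤ)) (fun _ _ h => by simpa using h)
    (fun i j => by simp only [ComplexShape.down_Rel]; omega)

/-- A projective resolution as a `ℤ`-indexed complex, zero in negative degrees. -/
noncomputable abbrev resolutionComplex {M : ModuleCat.{u} Rᵐᵒᵖ} (P : ProjectiveResolution M) :
    ChainComplex (ModuleCat.{u} Rᵐᵒᵖ) ℤ :=
  P.complex.extend degreeEmbedding

lemma resolutionComplex_projective {M : ModuleCat.{u} Rᵐᵒᵖ} (P : ProjectiveResolution M) (i : ℤ) :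
    Projective ((resolutionComplex P).X i) := by
  by_cases h : ∃ n, degreeEmbedding.f n = i
  · obtain ⟨n, hn⟩ := h
    exact Projective.of_iso (P.complex.extendXIso degreeEmbedding hn).symm (P.projective n)
  · exact (P.complex.isZero_extend_X degreeEmbedding i
      fun n hn => h ⟨n, hn⟩).projective

/-- The homological functor `Tor^R(M, -)`. -/
noncomputable def tor (M : ModuleCat.{u} Rᵐᵒᵖ) : HomologicalFunctor 𝕜 R :=
  homologyTensor 𝕜 (resolutionComplex (projectiveResolution M))
    (resolutionComplex_projective _)

end Functors

section Cosyzygies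

variable (R : Type u) [Ring R]

open scoped ZeroObject

open MorphismProperty in
/-- A functorial factorization of morphisms of `R`-modules as a monomorphism followed by a morphism
with the right lifting property with respect to monomorphisms. -/
noncomputable abbrev monoFactorization :
    FunctorialFactorizationData (monomorphisms (ModuleCat.{u} R))
      (monomorphisms (ModuleCat.{u} R)).rlp :=
  functorialFactorizationData _ _

/-- The functor that sends an `R`-module `N` to the morphism `N ⟶ 0`. -/
@[simps]
noncomputable def toZero : ModuleCat.{u} R ⥤ Arrow (ModuleCat.{u} R) where
  obj N := Arrow.mk (0 : N ⟶ 0)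
  map f := Arrow.homMk f 0

/-- A functor that sends an `R`-module `N` to an injective `R`-module containing `N`. -/
noncomputable def injFunctor : ModuleCat.{u} R ⥤ ModuleCat.{u} R :=
  toZero R ⋙ (monoFactorization R).Z

/-- The natural embedding `N ⟶ injFunctor N`. -/
noncomputable def injEmbedding : 𝟭 (ModuleCat.{u} R) ⟶ injFunctor R where
  app N := (monoFactorization R).i.app (Arrow.mk (0 : N ⟶ 0))
  naturality _ _ f := (monoFactorization R).i.naturality ((toZero R).map f)

instance (N : ModuleCat.{u} R) : Mono ((injEmbedding R).app N) :=
  (monoFactorization R).hi (Arrow.mk (0 : N ⟶ 0))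

instance (N : ModuleCat.{u} R) : Injective ((injFunctor R).obj N) := by
  have h := (monoFactorization R).hp (Arrow.mk (0 : N ⟶ 0))
  rw [injective_iff_rlp_monomorphisms_zero]
  rwa [(isZero_zero (ModuleCat.{u} R)).eq_of_tgt
    ((monoFactorization R).p.app (Arrow.mk (0 : N ⟶ 0))) 0] at h

/-- The short exact sequence `0 → N → injFunctor N → ΩN → 0`. -/
noncomputable def cosyzygySequence : ModuleCat.{u} R ⥤ ShortComplex (ModuleCat.{u} R) where
  obj N := ShortComplex.mk ((injEmbedding R).app N) (cokernel.π ((injEmbedding R).app N))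
    (cokernel.condition _)
  map f :=
    { τ₁ := f
      τ₂ := (injFunctor R).map f
      τ₃ := cokernel.map _ _ f ((injFunctor R).map f) ((injEmbedding R).naturality f).symm
      comm₁₂ := (injEmbedding R).naturality f
      comm₂₃ := by simp }
  map_id N := by
    ext1
    · rfl
    · exact (injFunctor R).map_id N
    · refine coequalizer.hom_ext ?_
      simp
  map_comp f g := by
    ext1
    · rfl
    · exact (injFunctor R).map_comp f g
    · refine coequalizer.hom_ext ?_
      simp

lemma cosyzygySequence_shortExact (N : ModuleCat.{u} R) :
    ((cosyzygySequence R).obj N).ShortExact :=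
  ShortComplex.ShortExact.mk' (ShortComplex.exact_cokernel _)
    (inferInstanceAs (Mono ((injEmbedding R).app N)))
    (inferInstanceAs (Epi (cokernel.π ((injEmbedding R).app N))))

/-- The functor `N ↦ Ω^k N`: the `k`-th cosyzygy in the functorial injective resolution
`I^k = injFunctor (Ω^k N)` of `N`. -/
noncomputable def cosyzygy : ℕ → ModuleCat.{u} R ⥤ ModuleCat.{u} R
  | 0 => 𝟭 _
  | k + 1 => cosyzygy k ⋙ cosyzygySequence R ⋙ ShortComplex.π₃

/-- The natural map `I^k → Ω^(k+1) N`. -/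
noncomputable def cosyzygyπ (k : ℕ) : cosyzygy R k ⋙ injFunctor R ⟶ cosyzygy R (k + 1) where
  app N := ((cosyzygySequence R).obj ((cosyzygy R k).obj N)).g
  naturality _ _ f := ((cosyzygySequence R).map ((cosyzygy R k).map f)).comm₂₃

end Cosyzygies

section Completion

variable {𝕜 : Type w} [CommRing 𝕜] {R : Type u} [Ring R]

/-- The right satellites of a functor `F`: one has `S^0 F = F` and
`S^(k+1) F (N) = Coker (F(I^k) → F(Ω^(k+1) N))`. -/
noncomputable def satellite (F : ModuleCat.{u} R ⥤ ModuleCat.{u} 𝕜) :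
    ℕ → ModuleCat.{u} R ⥤ ModuleCat.{u} 𝕜
  | 0 => F
  | k + 1 => cokernel (Functor.whiskerRight (cosyzygyπ R k) F)

/-- The natural projection `F(Ω^k N) → S^k F (N)`. -/
noncomputable def satelliteπ (F : ModuleCat.{u} R ⥤ ModuleCat.{u} 𝕜) :
    ∀ k : ℕ, cosyzygy R k ⋙ F ⟶ satellite F k
  | 0 => F.leftUnitor.hom
  | k + 1 => cokernel.π (Functor.whiskerRight (cosyzygyπ R k) F)

/-- The connecting homomorphism `T_i(Ω^(k+1) N) → T_j(Ω^k N)`, where `i = j + 1`. -/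
noncomputable def cosyzygyδ (T : HomologicalFunctor 𝕜 R) (k : ℕ) (i j : ℤ) (h : j + 1 = i) :
    cosyzygy R (k + 1) ⋙ T.F i ⟶ cosyzygy R k ⋙ T.F j where
  app N := T.δ _ (cosyzygySequence_shortExact R ((cosyzygy R k).obj N)) i j h
  naturality _ _ f :=
    (T.δ_naturality ((cosyzygySequence R).map ((cosyzygy R k).map f))
      (cosyzygySequence_shortExact R _) (cosyzygySequence_shortExact R _) i j h).symm

lemma cosyzygyπ_δ (T : HomologicalFunctor 𝕜 R) (k : ℕ) (i j : ℤ) (h : j + 1 = i) :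
    Functor.whiskerRight (cosyzygyπ R k) (T.F i) ≫ cosyzygyδ T k i j h = 0 := by
  ext1
  funext N
  exact ModuleCat.hom_ext (T.exact₃ _ (cosyzygySequence_shortExact R ((cosyzygy R k).obj N))
    i j h).linearMap_comp_eq_zero

/-- The map `S^(k+1) T_i → S^k T_j`, where `i = j + 1`, induced by the connecting homomorphism. -/
noncomputable def satelliteMap (T : HomologicalFunctor 𝕜 R) (k : ℕ) (i j : ℤ) (h : j + 1 = i) :
    satellite (T.F i) (k + 1) ⟶ satellite (T.F j) k :=
  cokernel.desc _ (cosyzygyδ T k i j h ≫ satelliteπ (T.F j) k)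
    (by rw [← Category.assoc, cosyzygyπ_δ, zero_comp])

/-- The J-completion of a homological functor `T` in degree `i`, that is, the functor
`N ↦ lim_k S^k T_{k+i} (N)`. -/
noncomputable def jCompletion (T : HomologicalFunctor 𝕜 R) (i : ℤ) :
    ModuleCat.{u} R ⥤ ModuleCat.{u} 𝕜 :=
  limit (Functor.ofOpSequence (X := fun k : ℕ => satellite (T.F (k + i)) k)
    fun k => satelliteMap T k ((k + 1 : ℕ) + i) (k + i) (by push_cast; ring))

/-- Complete homology: the J-completion of `Tor^R(M, -)`. -/
noncomputable def completeHomology (𝕜 : Type w) [CommRing 𝕜] [Algebra 𝕜 R]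
    (M : ModuleCat.{u} Rᵐᵒᵖ) (i : ℤ) : ModuleCat.{u} R ⥤ ModuleCat.{u} 𝕜 :=
  jCompletion (tor 𝕜 M) i

end Completion

section Tate

variable {R : Type u} [Ring R]

/-- An acyclic complex `T` of projective modules is totally acyclic if `Hom(T, Q)` is acyclic
for every projective module `Q`. -/
structure IsTotallyAcyclic (T : ChainComplex (ModuleCat.{u} R) ℤ) : Prop where
  projective : ∀ i, Projective (T.X i)
  acyclic : T.Acyclic
  /-- exactness of `Hom(T_{i-1}, Q) → Hom(T_i, Q) → Hom(T_{i+1}, Q)` -/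
  hom_acyclic : ∀ (Q : ModuleCat.{u} R), Projective Q → ∀ (i : ℤ) (f : T.X i ⟶ Q),
    T.d (i + 1) i ≫ f = 0 → ∃ g : T.X (i - 1) ⟶ Q, T.d i (i - 1) ≫ g = f

/-- A complete projective resolution `T → P → M` of a right module `M`. -/
structure CompleteProjectiveResolution (M : ModuleCat.{u} Rᵐᵒᵖ) where
  /-- the totally acyclic complex -/
  T : ChainComplex (ModuleCat.{u} Rᵐᵒᵖ) ℤ
  isTotallyAcyclic : IsTotallyAcyclic T
  /-- the projective resolution -/
  P : ProjectiveResolution M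
  /-- the morphism from the totally acyclic complex to the projective resolution -/
  ϖ : T ⟶ resolutionComplex P
  eventually_isIso : ∃ n : ℤ, ∀ i, n ≤ i → IsIso (ϖ.f i)

/-- Tate homology: the functor `N ↦ H_i(T ⊗_R N)`. -/
noncomputable def tateHomology (𝕜 : Type w) [CommRing 𝕜] [Algebra 𝕜 R] {M : ModuleCat.{u} Rᵐᵒᵖ}
    (c : CompleteProjectiveResolution M) (i : ℤ) : ModuleCat.{u} R ⥤ ModuleCat.{u} 𝕜 :=
  (homologyTensor 𝕜 c.T c.isTotallyAcyclic.projective).F i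

end Tate

end CompleteHomology

/-! Tate homology is a homological functor in `N`, since `T` consists of projectives. The key point
is that it vanishes when `N` is injective. The connecting maps of `0 → Ω^k N → I^k → Ω^(k+1) N → 0`
are then isomorphisms, so the `k`-th satellite of Tate homology in degree `k + i` is Tate homology
in degree `i`. In large degrees Tate homology and Tor are isomorphic functors, so Tor also vanishes
on injectives there, and the inverse system defining complete homology is constant from some `k` on.
Hence the limit is `S^k Tor_{k+i}`, which is the `k`-th satellite of Tate homology in degree `k +
i`, hence Tate homology in degree `i`. Since Tor is exchanged for Tate homology in one degree only,
the comparison need not respect connecting maps.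

For the vanishing, let `C` be the cokernel of a differential of `T`, with its map `C → T_i` to the
next term. Every map from `C` to a projective factors through this one, and `H_{i+1}(T ⊗ N) = 0`
follows once `C ⊗ N → T_i ⊗ N` is injective. If `C` is finitely presented and `N` injective, linear
forms on `C` separate the elements of `C ⊗ N`, and each of them factors through `T_i`, which gives
injectivity (`tensorMap_injective_of_isStablyFinite`).

The terms of `T` and `P` may be infinitely generated, so `C` need not be finitely generated. It is
so up to projective summands: this weaker property (`IsStablyFinite`) holds for `M`, passes to
syzygies because the ring is noetherian, transfers from `P` to `T` in high degrees, and descends to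
all lower degrees of `T` by exactness of `Hom(T, Q)`. -/

namespace CompleteHomology

/-! ### Modules that are finitely generated up to projective summands -/

section StablyFinite

variable {A : Type u} [Ring A]

open scoped ZeroObject

/-- A module is stably finite if its identity is the sum of an endomorphism that factors through a
finitely generated module and one that factors through a projective module; equivalently, if it is
a direct summand of the sum of a finitely generated and a projective module. -/
def IsStablyFinite (C : ModuleCat.{u} A) : Prop :=
  ∃ (G Q : ModuleCat.{u} A) (α : C ⟶ G) (β : G ⟶ C) (γ : C ⟶ Q) (δ : Q ⟶ C),
    Module.Finite A G ∧ Projective Q ∧ α ≫ β + γ ≫ δ = 𝟙 C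

lemma IsStablyFinite.of_finite (C : ModuleCat.{u} A) [Module.Finite A C] : IsStablyFinite C :=
  ⟨C, 0, 𝟙 C, 𝟙 C, 0, 0, inferInstance, inferInstance, by simp⟩

lemma IsStablyFinite.of_iso {C C' : ModuleCat.{u} A} (e : C ≅ C') (h : IsStablyFinite C) :
    IsStablyFinite C' := by
  obtain ⟨G, Q, α, β, γ, δ, hG, hQ, h⟩ := h
  refine ⟨G, Q, e.inv ≫ α, β ≫ e.hom, e.inv ≫ γ, δ ≫ e.hom, hG, hQ, ?_⟩
  calc _ = e.inv ≫ (α ≫ β + γ ≫ δ) ≫ e.hom := by simp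
    _ = 𝟙 C' := by simp [h]

/-- A finitely generated module is a quotient of a finitely generated projective module. -/
lemma exists_finite_projective_epi (G : ModuleCat.{u} A) [Module.Finite A G] :
    ∃ (F : ModuleCat.{u} A) (e : F ⟶ G), Module.Finite A F ∧ Projective F ∧ Epi e := by
  obtain ⟨n, f, hf⟩ := Module.Finite.exists_fin' A G
  exact ⟨ModuleCat.of A (Fin n → A), ModuleCat.ofHom f,
    inferInstanceAs (Module.Finite A (Fin n → A)),
    (IsProjective.iff_projective (Fin n → A)).1 inferInstance,
    (ModuleCat.epi_iff_surjective _).2 hf⟩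

/-- A morphism from a finitely generated module to a projective module factors through a finitely
generated projective module. -/
lemma exists_finite_projective_factorization {G P : ModuleCat.{u} A} [Module.Finite A G]
    [Projective P] (h : G ⟶ P) :
    ∃ (F : ModuleCat.{u} A) (f : G ⟶ F) (p : F ⟶ P),
      Module.Finite A F ∧ Projective F ∧ f ≫ p = h := by
  have hP : Module.Projective A P := (IsProjective.iff_projective P).2 inferInstance
  obtain ⟨s, hs⟩ := Module.projective_def'.1 hP
  obtain ⟨X, hX⟩ := Module.Finite.fg_top (R := A) (M := G)
  classical
  -- `s` splits the free cover of `P` by the free module on its elements. The images of finitely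
  -- many generators of `G` involve only the finite set `S` of basis elements, so the free module on
  -- `S` is the required `F`.
  let S : Finset P := X.biUnion fun x => (s (h.hom x)).support
  have hS : ∀ x, s (h.hom x) ∈ Finsupp.supported A A (S : Set P) := by
    intro x
    have : (⊤ : Submodule A G) ≤ (Finsupp.supported A A (S : Set P)).comap (s ∘ₗ h.hom) := by
      rw [← hX, Submodule.span_le]
      intro y hy
      simp only [SetLike.mem_coe, Submodule.mem_comap, Finsupp.mem_supported]
      intro z hz
      exact Finset.mem_coe.2 (Finset.mem_biUnion.2 ⟨y, hy, hz⟩)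
    exact this trivial
  let e := Finsupp.supportedEquivFinsupp (M := A) (R := A) (S : Set P)
  refine ⟨ModuleCat.of A ((S : Set P) →₀ A),
    ModuleCat.ofHom (e.toLinearMap ∘ₗ (s ∘ₗ h.hom).codRestrict _ hS),
    ModuleCat.ofHom (Finsupp.linearCombination A id ∘ₗ Submodule.subtype _ ∘ₗ e.symm.toLinearMap),
    inferInstanceAs (Module.Finite A ((S : Set P) →₀ A)),
    (IsProjective.iff_projective ((S : Set P) →₀ A)).1 inferInstance, ?_⟩
  ext x
  simpa using LinearMap.congr_fun hs (h.hom x)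

lemma finite_of_mono [IsNoetherianRing A] {H G : ModuleCat.{u} A} [Module.Finite A G] (f : H ⟶ G)
    [Mono f] : Module.Finite A H :=
  have : IsNoetherian A G := isNoetherian_of_isNoetherianRing_of_finite A G
  Module.Finite.of_injective f.hom ((ModuleCat.mono_iff_injective f).1 inferInstance)

/-- A first syzygy of a stably finite module over a noetherian ring is stably finite. -/
lemma IsStablyFinite.syzygy [IsNoetherianRing A] {S : ShortComplex (ModuleCat.{u} A)}
    (hS : S.ShortExact) [Projective S.X₂] (h : IsStablyFinite S.X₃) : IsStablyFinite S.X₁ := by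
  obtain ⟨G, Q, α, β, γ, δ, hG, hQ, h⟩ := h
  have := hS.mono_f
  have := hS.epi_g
  obtain ⟨F, e, hF, hF', he⟩ := exists_finite_projective_epi G
  let u : S.X₂ ⟶ F := Projective.factorThru (S.g ≫ α) e
  have hu : u ≫ e = S.g ≫ α := Projective.factorThru_comp _ _
  let p : F ⟶ S.X₂ := Projective.factorThru (e ≫ β) S.g
  have hp : p ≫ S.g = e ≫ β := Projective.factorThru_comp _ _
  let d : Q ⟶ S.X₂ := Projective.factorThru δ S.g
  have hd : d ≫ S.g = δ := Projective.factorThru_comp _ _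
  -- Lifting `𝟙 = α ≫ β + γ ≫ δ` to `S.X₂` leaves an error that dies in `S.X₃`; `v` is this error as
  -- a map into `S.X₁`. On `S.X₁` the summand through `Q` vanishes and `u` lands in `kernel e`,
  -- which is finitely generated by noetherianity.
  let v : S.X₂ ⟶ S.X₁ := hS.exact.lift (𝟙 _ - u ≫ p - S.g ≫ γ ≫ d) (by
    simp only [Preadditive.sub_comp, Category.assoc, hp, hd, reassoc_of% hu, Category.id_comp]
    rw [sub_sub, ← Preadditive.comp_add, h, Category.comp_id, sub_self])
  have hv : v ≫ S.f = _ := hS.exact.lift_f _ _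
  refine ⟨kernel e, S.X₂, kernel.lift e (S.f ≫ u) (by simp [hu]),
    hS.exact.lift (kernel.ι e ≫ p) (by simp [hp]), S.f, v, finite_of_mono (kernel.ι e),
    inferInstance, ?_⟩
  rw [← cancel_mono S.f]
  simp only [Preadditive.add_comp, Category.assoc, hv, ShortComplex.Exact.lift_f,
    kernel.lift_ι_assoc, Preadditive.comp_sub, S.zero_assoc, zero_comp, Category.comp_id,
    Category.id_comp]
  abel

/-- Let `Z → P → C → 0` be exact with `P` projective, such that every morphism from `Z` to a
projective module extends to `P`. If `Z` is stably finite, then so is `C`. -/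
lemma IsStablyFinite.cosyzygy {S : ShortComplex (ModuleCat.{u} A)} (hS : S.Exact) [Epi S.g]
    [Projective S.X₂]
    (hext : ∀ (Q : ModuleCat.{u} A), Projective Q → ∀ f : S.X₁ ⟶ Q, ∃ g, S.f ≫ g = f)
    (h : IsStablyFinite S.X₁) : IsStablyFinite S.X₃ := by
  obtain ⟨G, Q, α, β, γ, δ, hG, hQ, h⟩ := h
  obtain ⟨F, f, p, hF, hF', hfp⟩ := exists_finite_projective_factorization (β ≫ S.f)
  obtain ⟨u, hu⟩ := hext F hF' (α ≫ f)
  obtain ⟨c, hc⟩ := hext Q hQ γ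
  -- Dual to the syzygy argument: the decomposition of the identity of `S.X₁` extends to `S.X₂`,
  -- with an error that kills `S.f`. Modulo the image of `S.f`, the term through `Q` disappears and
  -- the one through `F` passes to `cokernel f`.
  let v : S.X₃ ⟶ S.X₂ := hS.desc (𝟙 _ - u ≫ p - c ≫ δ ≫ S.f) (by
    simp only [Preadditive.comp_sub, reassoc_of% hu, reassoc_of% hc, hfp, Category.comp_id]
    rw [sub_sub, ← Category.assoc, ← Category.assoc, ← Preadditive.add_comp, h, Category.id_comp,
      sub_self])
  have hv : S.g ≫ v = _ := hS.g_desc _ _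
  refine ⟨cokernel f, S.X₂, hS.desc (u ≫ cokernel.π f) (by simp [reassoc_of% hu]),
    cokernel.desc f (p ≫ S.g) (by simp [reassoc_of% hfp]), v, S.g,
    Module.Finite.of_surjective (cokernel.π f).hom
      ((ModuleCat.epi_iff_surjective _).1 inferInstance), inferInstance, ?_⟩
  rw [← cancel_epi S.g]
  simp only [Preadditive.comp_add, reassoc_of% hv, ShortComplex.Exact.g_desc_assoc, Category.assoc,
    cokernel.π_desc, Preadditive.sub_comp, S.zero, comp_zero, Category.comp_id,
    Category.id_comp]
  abel

end StablyFinite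

/-! ### Cokernels of consecutive differentials -/

section CokernelSequence

variable {C : Type*} [Category* C] [Abelian C]

/-- For a short complex `X₁ → X₂ → X₃`, the sequence
`Coker (X₁ → X₂) → X₃ → Coker (X₂ → X₃)`. -/
@[simps]
noncomputable def cokernelSequence (S : ShortComplex C) : ShortComplex C :=
  ShortComplex.mk (cokernel.desc S.f S.g S.zero) (cokernel.π S.g) (by
    rw [← cancel_epi (cokernel.π S.f)]; simp)

/-- Replacing `X₂` by its quotient `Coker (X₁ → X₂)` does not change the image in `X₃`. Exactness of
`S` matters only for injectivity of the first map. -/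
lemma cokernelSequence_exact (S : ShortComplex C) : (cokernelSequence S).Exact := by
  let φ : ShortComplex.mk S.g (cokernel.π S.g) (cokernel.condition _) ⟶ cokernelSequence S :=
    { τ₁ := cokernel.π S.f
      τ₂ := 𝟙 S.X₃
      τ₃ := 𝟙 (cokernel S.g)
      comm₁₂ := (cokernel.π_desc _ _ _).trans (Category.comp_id _).symm
      comm₂₃ := (Category.id_comp _).trans (Category.comp_id _).symm }
  have : Epi φ.τ₁ := inferInstanceAs (Epi (cokernel.π S.f))
  have : IsIso φ.τ₂ := inferInstanceAs (IsIso (𝟙 _))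
  have : Mono φ.τ₃ := inferInstanceAs (Mono (𝟙 _))
  exact (ShortComplex.exact_iff_of_epi_of_isIso_of_mono φ).1 (ShortComplex.exact_cokernel _)

instance (S : ShortComplex C) : Epi (cokernelSequence S).g :=
  inferInstanceAs (Epi (cokernel.π S.g))

lemma cokernelSequence_shortExact {S : ShortComplex C} (hS : S.Exact) :
    (cokernelSequence S).ShortExact :=
  ShortComplex.ShortExact.mk' (cokernelSequence_exact S) hS.mono_cokernelDesc inferInstance

end CokernelSequence

/-! ### Syzygies of complete resolutions are stably finite -/

section CompleteResolution

variable {R : Type u} [Ring R] {M : ModuleCat.{u} Rᵐᵒᵖ}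

/-- The cokernel in degree `0` is `M`, and each later one is a first syzygy of its predecessor. -/
lemma isStablyFinite_cokernel_resolution [IsNoetherianRing Rᵐᵒᵖ] [Module.Finite Rᵐᵒᵖ M]
    (P : ProjectiveResolution M) (n : ℕ) : IsStablyFinite (cokernel (P.complex.d (n + 1) n)) := by
  induction n with
  | zero =>
    exact (IsStablyFinite.of_finite M).of_iso
      (P.isColimitCokernelCofork.coconePointUniqueUpToIso (colimit.isColimit _))
  | succ n ih =>
    have : Projective (cokernelSequence (ShortComplex.mk _ _
        (P.complex.d_comp_d (n + 2) (n + 1) n))).X₂ := P.projective n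
    exact ih.syzygy (cokernelSequence_shortExact (P.exact_succ n))

lemma isStablyFinite_cokernel_resolutionComplex [IsNoetherianRing Rᵐᵒᵖ] [Module.Finite Rᵐᵒᵖ M]
    (P : ProjectiveResolution M) {i : ℤ} (hi : 0 ≤ i) :
    IsStablyFinite (cokernel ((resolutionComplex P).d (i + 1) i)) := by
  lift i to ℕ using hi
  refine (isStablyFinite_cokernel_resolution P i).of_iso (cokernel.mapIso _ _
    (P.complex.extendXIso degreeEmbedding (i := i + 1) (by simp)).symm
    (P.complex.extendXIso degreeEmbedding (i := i) (by simp)).symm ?_)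
  rw [P.complex.extend_d_eq degreeEmbedding (i := i + 1) (j := i) (by simp) (by simp)]
  simp

/-- A map from the cokernel to `Q` is a cocycle of `Hom(T, Q)`, and an extension to `T_i` exhibits
it as a coboundary. -/
lemma IsTotallyAcyclic.exists_extension {A : Type u} [Ring A] {T : ChainComplex (ModuleCat.{u} A) ℤ}
    (hT : IsTotallyAcyclic T) (i : ℤ) {Q : ModuleCat.{u} A} [Projective Q]
    (f : cokernel (T.d (i + 1 + 1) (i + 1)) ⟶ Q) :
    ∃ g, cokernel.desc _ (T.d (i + 1) i) (T.d_comp_d _ _ _) ≫ g = f := by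
  obtain ⟨g, hg⟩ : ∃ g, T.d (i + 1) i ≫ g = cokernel.π _ ≫ f := by
    have := hT.hom_acyclic Q inferInstance (i + 1) (cokernel.π _ ≫ f) (by simp)
    rwa [add_sub_cancel_right] at this
  exact ⟨g, by rw [← cancel_epi (cokernel.π _)]; simpa using hg⟩

/-- The syzygies of a complete projective resolution of a finitely generated module are stably
finite. -/
lemma CompleteProjectiveResolution.isStablyFinite_cokernel [IsNoetherianRing Rᵐᵒᵖ]
    [Module.Finite Rᵐᵒᵖ M] (c : CompleteProjectiveResolution M) (i : ℤ) :
    IsStablyFinite (cokernel (c.T.d (i + 1) i)) := by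
  obtain ⟨n, hn⟩ := c.eventually_isIso
  -- Downward induction on the degree, with `k` bounding the distance to the range where `ϖ` is
  -- invertible; the maximum with `0` keeps the base case within the degrees of the resolution `P`.
  have key : ∀ (k : ℕ) (i : ℤ), max n 0 ≤ i + k → IsStablyFinite (cokernel (c.T.d (i + 1) i)) := by
    intro k
    induction k with
    | zero =>
      intro i hi
      have := hn i (by omega)
      have := hn (i + 1) (by omega)
      exact (isStablyFinite_cokernel_resolutionComplex c.P (by omega)).of_iso
        (cokernel.mapIso _ _ (asIso (c.ϖ.f (i + 1))) (asIso (c.ϖ.f i)) (by simp)).symm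
    | succ k ih =>
      intro i hi
      have : Projective (cokernelSequence (ShortComplex.mk _ _
        (c.T.d_comp_d (i + 1 + 1) (i + 1) i))).X₂ := c.isTotallyAcyclic.projective i
      refine IsStablyFinite.cosyzygy (cokernelSequence_exact
        (ShortComplex.mk _ _ (c.T.d_comp_d (i + 1 + 1) (i + 1) i))) ?_ (ih (i + 1) (by omega))
      exact fun Q hQ f => c.isTotallyAcyclic.exists_extension i f
  exact key (max n 0 - i).toNat i (by omega)

end CompleteResolution

/-! ### Linear forms on `M` and the elements of `M ⊗_R N` -/

section Evaluation

variable (𝕜 : Type w) {R : Type u} [CommRing 𝕜] [Ring R] [Algebra 𝕜 R]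
  {M M' N : Type u} [AddCommGroup M] [AddCommGroup M'] [AddCommGroup N]
  [Module Rᵐᵒᵖ M] [Module Rᵐᵒᵖ M'] [Module R N] [Module 𝕜 M] [Module 𝕜 M'] [Module 𝕜 N]
  [IsScalarTower 𝕜 Rᵐᵒᵖ M] [IsScalarTower 𝕜 Rᵐᵒᵖ M'] [IsScalarTower 𝕜 R N]

/-- The map `M ⊗_R N → N` given by a linear form on `M`. -/
def btEval (a : M →ₗ[Rᵐᵒᵖ] Rᵐᵒᵖ) : BalancedTensor 𝕜 R M N →ₗ[𝕜] N :=
  btLift 𝕜 R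
    (LinearMap.mk₂ 𝕜 (fun m n => (a m).unop • n)
      (fun m m' n => by simp [add_smul])
      (fun c m n => by simp [LinearMap.map_smul_of_tower])
      (fun m n n' => smul_add _ _ _)
      (fun c m n => smul_algebra_smul_comm c (a m).unop n))
    fun m r n => by simp [mul_smul]

lemma btEval_bt (a : M →ₗ[Rᵐᵒᵖ] Rᵐᵒᵖ) (m : M) (n : N) :
    btEval 𝕜 a (bt 𝕜 R m n) = (a m).unop • n := rfl

lemma btEval_btMap (f : M' →ₗ[Rᵐᵒᵖ] M) (a : M →ₗ[Rᵐᵒᵖ] Rᵐᵒᵖ) (x : BalancedTensor 𝕜 R M' N) :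
    btEval 𝕜 a (btMap 𝕜 R f LinearMap.id x) = btEval 𝕜 (a ∘ₗ f) x :=
  LinearMap.congr_fun (bt_hom_ext (f := btEval 𝕜 a ∘ₗ btMap 𝕜 R f LinearMap.id)
    (g := btEval 𝕜 (a ∘ₗ f)) fun _ _ => rfl) x

lemma bt_sum {ι : Type*} (s : Finset ι) (m : M) (n : ι → N) :
    bt 𝕜 R m (∑ i ∈ s, n i) = ∑ i ∈ s, bt 𝕜 R m (n i) := by
  classical
  induction s using Finset.induction_on with
  | empty => simp [bt_zero]
  | insert i s hi ih => rw [Finset.sum_insert hi, Finset.sum_insert hi, bt_add, ih]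

lemma sum_bt {ι : Type*} (s : Finset ι) (m : ι → M) (n : N) :
    bt 𝕜 R (∑ i ∈ s, m i) n = ∑ i ∈ s, bt 𝕜 R (m i) n := by
  classical
  induction s using Finset.induction_on with
  | empty => simp [zero_bt]
  | insert i s hi ih => rw [Finset.sum_insert hi, Finset.sum_insert hi, add_bt, ih]

lemma exists_eq_sum_bt {ι : Type*} [Fintype ι] {g : ι → M}
    (hg : Submodule.span Rᵐᵒᵖ (Set.range g) = ⊤) (x : BalancedTensor 𝕜 R M N) :
    ∃ v : ι → N, x = ∑ i, bt 𝕜 R (g i) (v i) := by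
  induction x using bt_induction with
  | zero => exact ⟨0, by simp [bt_zero]⟩
  | tmul m n =>
    obtain ⟨c, rfl⟩ := (Submodule.mem_span_range_iff_exists_fun Rᵐᵒᵖ).1
      (hg.symm ▸ Submodule.mem_top : m ∈ Submodule.span Rᵐᵒᵖ (Set.range g))
    refine ⟨fun i => (c i).unop • n, ?_⟩
    rw [sum_bt]
    exact Finset.sum_congr rfl fun i _ => bt_balanced 𝕜 R (g i) (c i).unop n
  | add x y hx hy =>
    obtain ⟨v, rfl⟩ := hx
    obtain ⟨w, rfl⟩ := hy
    exact ⟨v + w, by simp [bt_add, Finset.sum_add_distrib]⟩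

/-- The quotient of `X` by the kernel of `f` embeds in `Y`, and `g` descends to this quotient. -/
lemma exists_comp_eq_of_injective {X Y : Type u} [AddCommGroup X] [AddCommGroup Y]
    [Module R X] [Module R Y] [Module.Injective R N] (f : X →ₗ[R] Y) (g : X →ₗ[R] N)
    (h : LinearMap.ker f ≤ LinearMap.ker g) : ∃ e : Y →ₗ[R] N, e ∘ₗ f = g := by
  obtain ⟨e, he⟩ := Module.Injective.out ((LinearMap.ker f).liftQ f le_rfl)
    (LinearMap.ker_eq_bot.1 (Submodule.ker_liftQ_eq_bot _ _ _ le_rfl)) ((LinearMap.ker f).liftQ g h)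
  exact ⟨e, LinearMap.ext fun x => he (Submodule.Quotient.mk x)⟩

/-- For a finitely presented module `M` and an injective module `N`, the linear forms on `M`
separate the elements of `M ⊗_R N`. -/
lemma eq_zero_of_forall_btEval_eq_zero [IsNoetherianRing Rᵐᵒᵖ] [Module.Finite Rᵐᵒᵖ M]
    [Module.Injective R N] (x : BalancedTensor 𝕜 R M N)
    (hx : ∀ a : M →ₗ[Rᵐᵒᵖ] Rᵐᵒᵖ, btEval 𝕜 a x = 0) : x = 0 := by
  obtain ⟨n, q, hq⟩ := Module.Finite.exists_fin' Rᵐᵒᵖ M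
  obtain ⟨m, d, hd⟩ := Submodule.fg_iff_exists_fin_generating_family.1
    (IsNoetherian.noetherian (LinearMap.ker q))
  let g : Fin n → M := fun i => q (Pi.single i 1)
  have hqg : ∀ c : Fin n → Rᵐᵒᵖ, q c = ∑ i, c i • g i := fun c => by
    conv_lhs => rw [pi_eq_sum_univ' c]
    simp [g, map_sum]
  have hg : Submodule.span Rᵐᵒᵖ (Set.range g) = ⊤ := by
    refine eq_top_iff.2 fun y _ => ?_
    obtain ⟨c, rfl⟩ := hq y
    exact (Submodule.mem_span_range_iff_exists_fun Rᵐᵒᵖ).2 ⟨c, (hqg c).symm⟩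
  obtain ⟨v, rfl⟩ := exists_eq_sum_bt 𝕜 hg x
  -- `A` is the transpose of the relation matrix of `M`: its kernel consists of the value vectors on
  -- the generators `g i` of the linear forms on `M`.
  let A : (Fin n → R) →ₗ[R] (Fin m → R) :=
    LinearMap.pi fun k => Fintype.linearCombination R fun i => (d k i).unop
  have hA : ∀ a k, A a k = ∑ i, a i * (d k i).unop := fun a k => by
    simp [A, Fintype.linearCombination_apply]
  -- A form with values `a i` sends `x` to `∑ a i • v i`, so `hx` says that `a ↦ ∑ a i • v i`
  -- vanishes on the kernel of `A`. Injectivity of `N` then writes the `v i` as combinations of the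
  -- elements `e (Pi.single k 1)` with the relations `d k` as coefficients.
  obtain ⟨e, he⟩ := exists_comp_eq_of_injective A (Fintype.linearCombination R v) (by
    intro a ha
    let b : (Fin n → Rᵐᵒᵖ) →ₗ[Rᵐᵒᵖ] Rᵐᵒᵖ :=
      Fintype.linearCombination Rᵐᵒᵖ fun i => MulOpposite.op (a i)
    have hb : LinearMap.ker q ≤ LinearMap.ker b := by
      rw [← hd, Submodule.span_le]
      rintro _ ⟨k, rfl⟩
      have := congrFun (LinearMap.mem_ker.1 ha) k
      rw [hA] at this
      apply MulOpposite.unop_injective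
      simpa [b, Fintype.linearCombination_apply] using this
    let a' : M →ₗ[Rᵐᵒᵖ] Rᵐᵒᵖ :=
      (LinearMap.ker q).liftQ b hb ∘ₗ (q.quotKerEquivOfSurjective hq).symm.toLinearMap
    have ha' : ∀ c, a' (q c) = b c := fun c => by
      have : (q.quotKerEquivOfSurjective hq).symm (q c) = Submodule.Quotient.mk c :=
        (LinearEquiv.symm_apply_eq _).2 rfl
      simp only [a', LinearMap.comp_apply, LinearEquiv.coe_coe, this]
      rfl
    have h := hx a'
    rw [map_sum] at h
    rw [LinearMap.mem_ker, ← h, Fintype.linearCombination_apply]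
    refine Finset.sum_congr rfl fun i _ => ?_
    rw [btEval_bt, ha']
    simp [b])
  have hv : ∀ i, v i = ∑ k, (d k i).unop • e (Pi.single k 1) := fun i => by
    have h1 : v i = e (A (Pi.single i 1)) := by
      rw [← LinearMap.comp_apply, he]
      simp
    rw [h1]
    conv_lhs => rw [pi_eq_sum_univ' (A (Pi.single i 1))]
    simp [map_sum, hA, Pi.single_apply]
  calc ∑ i, bt 𝕜 R (g i) (v i)
      = ∑ i, ∑ k, bt 𝕜 R (d k i • g i) (e (Pi.single k 1)) :=
        Finset.sum_congr rfl fun i _ => by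
          rw [hv, bt_sum]
          exact Finset.sum_congr rfl fun k _ => (bt_balanced 𝕜 R (g i) (d k i).unop _).symm
    _ = ∑ k, bt 𝕜 R (q (d k)) (e (Pi.single k 1)) := by
        rw [Finset.sum_comm]
        exact Finset.sum_congr rfl fun k _ => by rw [hqg, sum_bt]
    _ = 0 := Finset.sum_eq_zero fun k _ => by
        have : d k ∈ LinearMap.ker q := hd ▸ Submodule.subset_span ⟨k, rfl⟩
        rw [LinearMap.mem_ker.1 this, zero_bt]

/-- Right exactness of the tensor product: choosing preimages under `g` gives a well-defined map
from `M'' ⊗ N` back to the cokernel of `f ⊗ N`, as two preimages differ by an element of the image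
of `f`. -/
lemma btMap_exact_left {M'' : Type u} [AddCommGroup M''] [Module Rᵐᵒᵖ M''] [Module 𝕜 M'']
    [IsScalarTower 𝕜 Rᵐᵒᵖ M''] {f : M →ₗ[Rᵐᵒᵖ] M'} {g : M' →ₗ[Rᵐᵒᵖ] M''}
    (h : Function.Exact f g) (hg : Function.Surjective g) (x : BalancedTensor 𝕜 R M' N)
    (hx : btMap 𝕜 R g LinearMap.id x = 0) : ∃ y, btMap 𝕜 R f LinearMap.id y = x := by
  let p := (LinearMap.range (btMap 𝕜 R f (LinearMap.id : N →ₗ[R] N))).mkQ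
  have hp : ∀ (m m' : M') (n : N), g m = g m' → p (bt 𝕜 R m n) = p (bt 𝕜 R m' n) := by
    intro m m' n hm
    obtain ⟨l, hl⟩ := (h (m - m')).1 (by rw [map_sub, hm, sub_self])
    rw [← sub_add_cancel m m', ← hl, add_bt, map_add, add_eq_right]
    exact (Submodule.Quotient.mk_eq_zero _).2 ⟨bt 𝕜 R l n, rfl⟩
  have hs := Function.surjInv_eq hg
  let e := btLift 𝕜 R (M := M'') (N := N)
    (LinearMap.mk₂ 𝕜 (fun m n => p (bt 𝕜 R (Function.surjInv hg m) n))
      (fun m m' n => by rw [← map_add, ← add_bt]; exact hp _ _ _ (by simp [hs]))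
      (fun c m n => by
        rw [← map_smul, ← smul_bt]
        exact hp _ _ _ (by rw [LinearMap.map_smul_of_tower, hs, hs]))
      (fun m n n' => by rw [bt_add, map_add])
      (fun c m n => by rw [bt_smul, map_smul]))
    (fun m r n => by
      simp only [LinearMap.mk₂_apply, ← bt_balanced]
      exact hp _ _ _ (by rw [map_smul, hs, hs]))
  have he : e ∘ₗ btMap 𝕜 R g LinearMap.id = p := bt_hom_ext fun m n => hp _ _ _ (hs _)
  have := LinearMap.congr_fun he x
  rw [LinearMap.comp_apply, hx, map_zero] at this
  exact (Submodule.Quotient.mk_eq_zero _).1 this.symm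

end Evaluation

/-! ### Vanishing of Tate homology on injective modules -/

section TensorInjective

variable (𝕜 : Type w) [CommRing 𝕜] {R : Type u} [Ring R] [Algebra 𝕜 R]

attribute [local instance] baseModule baseModule_isScalarTower

/-- If every morphism from a stably finite module `C` to a projective module factors through `f`,
then `f ⊗_R N` is injective for every injective module `N`. -/
lemma tensorMap_injective_of_isStablyFinite [IsNoetherianRing Rᵐᵒᵖ] {C F : ModuleCat.{u} Rᵐᵒᵖ}
    (hC : IsStablyFinite C) (f : C ⟶ F)
    (hf : ∀ (Q : ModuleCat.{u} Rᵐᵒᵖ), Projective Q → ∀ g : C ⟶ Q, ∃ h, f ≫ h = g)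
    (N : ModuleCat.{u} R) [Injective N] : Function.Injective (tensorMap 𝕜 f (𝟙 N)).hom := by
  obtain ⟨G, Q, α, β, γ, δ, hG, hQ, h⟩ := hC
  have hN : Injective (ModuleCat.of R N) := ‹_›
  have := Module.injective_module_of_injective_object R N
  suffices key : ∀ x : BalancedTensor 𝕜 R C N, btMap 𝕜 R f.hom LinearMap.id x = 0 → x = 0 from
    (injective_iff_map_eq_zero (tensorMap 𝕜 f (𝟙 N)).hom).2 key
  intro x hx
  have hα : btMap 𝕜 R α.hom LinearMap.id x = 0 := by
    refine eq_zero_of_forall_btEval_eq_zero 𝕜 _ fun a => ?_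
    -- A linear form on `G`, pulled back to `C`, is a map to the projective module `R`, so it
    -- factors through `f` and kills `x`. Thus the forms on the finitely generated module `G` cannot
    -- see the image of `x`.
    obtain ⟨b, hb⟩ := hf (ModuleCat.of Rᵐᵒᵖ Rᵐᵒᵖ)
      ((IsProjective.iff_projective Rᵐᵒᵖ).1 inferInstance) (α ≫ ModuleCat.ofHom a)
    have hb' : a ∘ₗ α.hom = b.hom ∘ₗ f.hom := (congrArg ModuleCat.Hom.hom hb).symm
    rw [btEval_btMap, hb', ← btEval_btMap, hx, map_zero]
  have hγ : btMap 𝕜 R γ.hom LinearMap.id x = 0 := by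
    obtain ⟨c, hc⟩ := hf Q hQ γ
    have hc' : γ.hom = c.hom ∘ₗ f.hom := (congrArg ModuleCat.Hom.hom hc).symm
    have := btMap_comp_apply 𝕜 R f.hom c.hom LinearMap.id LinearMap.id x
    rw [hx, map_zero, ← hc'] at this
    exact this.symm
  have hid : LinearMap.id = β.hom ∘ₗ α.hom + δ.hom ∘ₗ γ.hom :=
    (congrArg ModuleCat.Hom.hom h).symm
  have h1 := btMap_comp_apply 𝕜 R α.hom β.hom LinearMap.id LinearMap.id x
  have h2 := btMap_comp_apply 𝕜 R γ.hom δ.hom LinearMap.id LinearMap.id x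
  rw [hα, map_zero] at h1
  rw [hγ, map_zero] at h2
  have h3 := LinearMap.congr_fun (btMap_id 𝕜 R (M := C) (N := N)) x
  rw [hid, btMap_add_left, LinearMap.add_apply] at h3
  exact h3.symm.trans ((congrArg₂ (· + ·) h1 h2).symm.trans (add_zero _))

lemma tensorMap_cokernel_exact {X Y : ModuleCat.{u} Rᵐᵒᵖ} (f : X ⟶ Y) (N : ModuleCat.{u} R)
    (x : tensorObj 𝕜 Y N) (hx : (tensorMap 𝕜 (cokernel.π f) (𝟙 N)).hom x = 0) :
    ∃ y, (tensorMap 𝕜 f (𝟙 N)).hom y = x :=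
  btMap_exact_left 𝕜
    ((ShortComplex.ShortExact.moduleCat_exact_iff_function_exact _).1
      (ShortComplex.exact_cokernel f))
    ((ModuleCat.epi_iff_surjective _).1 (inferInstanceAs (Epi (cokernel.π f)))) x hx

/-- The differential is `T_{i+1} → C → T_i` with `C` a stably finite cokernel. After tensoring, the
second map is injective, and right exactness identifies the kernel of the first with the boundaries.
-/
lemma CompleteProjectiveResolution.tensorComplex_exactAt [IsNoetherianRing Rᵐᵒᵖ]
    {M : ModuleCat.{u} Rᵐᵒᵖ} [Module.Finite Rᵐᵒᵖ M] (c : CompleteProjectiveResolution M)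
    (N : ModuleCat.{u} R) [Injective N] (i : ℤ) : ((tensorComplex 𝕜 c.T).obj N).ExactAt i := by
  obtain ⟨i, rfl⟩ : ∃ j, j + 1 = i := ⟨i - 1, by omega⟩
  rw [HomologicalComplex.exactAt_iff' _ (i + 1 + 1) (i + 1) i (by simp) (by simp),
    ShortComplex.moduleCat_exact_iff]
  intro x hx
  apply tensorMap_cokernel_exact
  apply tensorMap_injective_of_isStablyFinite 𝕜 (c.isStablyFinite_cokernel (i + 1))
    (cokernel.desc _ (c.T.d (i + 1) i) (c.T.d_comp_d _ _ _))
    (fun Q hQ g => c.isTotallyAcyclic.exists_extension i g)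
  have h := tensorMap_comp 𝕜 (cokernel.π (c.T.d (i + 1 + 1) (i + 1)))
    (cokernel.desc _ (c.T.d (i + 1) i) (c.T.d_comp_d _ _ _)) (𝟙 N) (𝟙 N)
  rw [cokernel.π_desc, Category.comp_id] at h
  exact ((LinearMap.congr_fun (congrArg ModuleCat.Hom.hom h) x).symm.trans hx).trans
    (map_zero _).symm

/-- Tate homology vanishes on injective modules. -/
lemma tateHomology_isZero_of_injective [IsNoetherianRing Rᵐᵒᵖ]
    {M : ModuleCat.{u} Rᵐᵒᵖ} [Module.Finite Rᵐᵒᵖ M] (c : CompleteProjectiveResolution M)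
    (N : ModuleCat.{u} R) [Injective N] (i : ℤ) : IsZero ((tateHomology 𝕜 c i).obj N) :=
  (c.tensorComplex_exactAt 𝕜 N i).isZero_homology

end TensorInjective

/-! ### Comparison of Tate homology with Tor in large degrees -/

section TensorFunctoriality

variable (𝕜 : Type w) [CommRing 𝕜] {R : Type u} [Ring R] [Algebra 𝕜 R]
  {K L : ChainComplex (ModuleCat.{u} Rᵐᵒᵖ) ℤ}

/-- The morphism `K ⊗_R N → L ⊗_R N` given by a morphism of complexes `K → L`, natural in `N`. -/
noncomputable def tensorComplexMap (f : K ⟶ L) :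
    tensorComplex 𝕜 (R := R) K ⟶ tensorComplex 𝕜 L where
  app N := (((tensorFunctor 𝕜).obj N).mapHomologicalComplex _).map f
  naturality _ _ g :=
    ((NatTrans.mapHomologicalComplex ((tensorFunctor 𝕜).map g) _).naturality f).symm

/-- The map induced in homology by `tensorComplexMap`. -/
noncomputable def tensorHomologyMap (f : K ⟶ L) (i : ℤ) :
    tensorComplex 𝕜 (R := R) K ⋙ HomologicalComplex.homologyFunctor _ _ i ⟶
      tensorComplex 𝕜 L ⋙ HomologicalComplex.homologyFunctor _ _ i :=
  Functor.whiskerRight (tensorComplexMap 𝕜 f) _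

lemma isIso_tensorHomologyMap_of_isIso (f : K ⟶ L) (i : ℤ) (h₁ : IsIso (f.f (i + 1)))
    (h₂ : IsIso (f.f i)) (h₃ : IsIso (f.f (i - 1))) : IsIso (tensorHomologyMap 𝕜 f i) := by
  rw [NatTrans.isIso_iff_isIso_app]
  intro N
  let φ := (tensorComplexMap 𝕜 f).app N
  have key : ∀ j, IsIso (f.f j) → IsIso (φ.f j) := fun j _ =>
    inferInstanceAs (IsIso (((tensorFunctor 𝕜).obj N).map (f.f j)))
  change IsIso (HomologicalComplex.homologyMap φ i)
  let ψ := (HomologicalComplex.shortComplexFunctor (ModuleCat.{u} 𝕜) (ComplexShape.down ℤ) i).map φ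
  have : IsIso ψ.τ₁ := key _ ((ChainComplex.prev ℤ i).symm ▸ h₁)
  have : IsIso ψ.τ₂ := key _ h₂
  have : IsIso ψ.τ₃ := key _ ((ChainComplex.next ℤ i).symm ▸ h₃)
  exact inferInstanceAs (IsIso (ShortComplex.homologyMap ψ))

lemma isIso_tensorHomologyMap_of_homotopyEquiv (e : HomotopyEquiv K L) (i : ℤ) :
    IsIso (tensorHomologyMap 𝕜 e.hom i) := by
  rw [NatTrans.isIso_iff_isIso_app]
  intro N
  exact inferInstanceAs (IsIso
    ((((tensorFunctor 𝕜).obj N).mapHomotopyEquiv e).toHomologyIso i).hom)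

instance : degreeEmbedding.IsRelIff :=
  ⟨fun i j h => by exact_mod_cast (show (j : ℤ) + 1 = i by simpa using h)⟩

/-- Projective resolutions of a module are homotopy equivalent as `ℤ`-indexed complexes. -/
noncomputable def resolutionComplexHomotopyEquiv {M : ModuleCat.{u} Rᵐᵒᵖ}
    (P Q : ProjectiveResolution M) :
    HomotopyEquiv (resolutionComplex P) (resolutionComplex Q) where
  hom := HomologicalComplex.extendMap (P.homotopyEquiv Q).hom degreeEmbedding
  inv := HomologicalComplex.extendMap (P.homotopyEquiv Q).inv degreeEmbedding
  homotopyHomInvId := ((Homotopy.ofEq (HomologicalComplex.extendMap_comp _ _ _).symm).trans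
    ((P.homotopyEquiv Q).homotopyHomInvId.extend degreeEmbedding)).trans
      (Homotopy.ofEq (HomologicalComplex.extendMap_id _ _))
  homotopyInvHomId := ((Homotopy.ofEq (HomologicalComplex.extendMap_comp _ _ _).symm).trans
    ((P.homotopyEquiv Q).homotopyInvHomId.extend degreeEmbedding)).trans
      (Homotopy.ofEq (HomologicalComplex.extendMap_id _ _))

/-- The comparison passes through `P`: from `T` by `ϖ`, then to the resolution chosen to define Tor
by a homotopy equivalence. -/
lemma exists_tateHomology_iso_tor {M : ModuleCat.{u} Rᵐᵒᵖ} (c : CompleteProjectiveResolution M) :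
    ∃ n : ℤ, ∀ i, n ≤ i → Nonempty (tateHomology 𝕜 c i ≅ (tor 𝕜 M).F i) := by
  obtain ⟨n, hn⟩ := c.eventually_isIso
  -- Homology in degree `i` also involves degree `i - 1`, hence the shift by one.
  refine ⟨n + 1, fun i hi => ?_⟩
  have h₁ := isIso_tensorHomologyMap_of_isIso 𝕜 c.ϖ i (hn _ (by omega)) (hn _ (by omega))
    (hn _ (by omega))
  have h₂ := isIso_tensorHomologyMap_of_homotopyEquiv 𝕜
    (resolutionComplexHomotopyEquiv c.P (projectiveResolution M)) i
  exact ⟨(@asIso _ _ _ _ _ h₁).trans (@asIso _ _ _ _ _ h₂)⟩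

end TensorFunctoriality

/-! ### Satellites of functors that vanish on injective modules -/

section Completion

variable {𝕜 : Type w} [CommRing 𝕜] {R : Type u} [Ring R]

/-- Isomorphic functors have isomorphic satellites. -/
noncomputable def satelliteIso {F F' : ModuleCat.{u} R ⥤ ModuleCat.{u} 𝕜} (e : F ≅ F') :
    ∀ k : ℕ, satellite F k ≅ satellite F' k
  | 0 => e
  | k + 1 => cokernel.mapIso (Functor.whiskerRight (cosyzygyπ R k) F)
      (Functor.whiskerRight (cosyzygyπ R k) F') (Functor.isoWhiskerLeft _ e)
      (Functor.isoWhiskerLeft _ e) (by ext1; funext N; exact e.hom.naturality _)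

variable (T : HomologicalFunctor 𝕜 R)

/-- In the long exact sequence the neighbours of the connecting map are the values at the injective
`I^k`. Vanishing is required in the two degrees `i` and `j` only, so that the lemma applies to Tor
in large degrees. -/
lemma isIso_cosyzygyδ {i j : ℤ} (h : j + 1 = i)
    (hi : ∀ N : ModuleCat.{u} R, Injective N → IsZero ((T.F i).obj N))
    (hj : ∀ N : ModuleCat.{u} R, Injective N → IsZero ((T.F j).obj N)) (k : ℕ) :
    IsIso (cosyzygyδ T k i j h) := by
  rw [NatTrans.isIso_iff_isIso_app]
  intro N
  let S := (cosyzygySequence R).obj ((cosyzygy R k).obj N)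
  have hS : S.ShortExact := cosyzygySequence_shortExact R _
  have hS₂ : Injective S.X₂ := inferInstanceAs (Injective ((injFunctor R).obj _))
  have hi' := ModuleCat.subsingleton_of_isZero (hi S.X₂ hS₂)
  have hj' := ModuleCat.subsingleton_of_isZero (hj S.X₂ hS₂)
  refine (ConcreteCategory.isIso_iff_bijective (T.δ S hS i j h)).2 ⟨?_, ?_⟩
  · refine (injective_iff_map_eq_zero (T.δ S hS i j h).hom).2 fun x hx => ?_
    obtain ⟨y, rfl⟩ := (T.exact₃ S hS i j h x).1 hx
    rw [Subsingleton.elim y 0, map_zero]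
  · exact fun x => (T.exact₁ S hS i j h x).1 (Subsingleton.elim _ _)

/-- The satellite is the cokernel of a map out of `F(I^k) = 0`. -/
lemma isIso_satelliteπ {F : ModuleCat.{u} R ⥤ ModuleCat.{u} 𝕜}
    (hF : ∀ N : ModuleCat.{u} R, Injective N → IsZero (F.obj N)) :
    ∀ k : ℕ, IsIso (satelliteπ F k)
  | 0 => inferInstanceAs (IsIso F.leftUnitor.hom)
  | k + 1 => by
    have h : Functor.whiskerRight (cosyzygyπ R k) F = 0 := by
      ext1
      funext N
      exact (hF _ (inferInstanceAs (Injective ((injFunctor R).obj _)))).eq_of_src _ _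
    change IsIso (cokernel.π (Functor.whiskerRight (cosyzygyπ R k) F))
    rw [h]
    infer_instance

/-- The projections onto the satellites are isomorphisms that turn this map into the connecting
homomorphism. -/
lemma isIso_satelliteMap {i j : ℤ} (h : j + 1 = i)
    (hi : ∀ N : ModuleCat.{u} R, Injective N → IsZero ((T.F i).obj N))
    (hj : ∀ N : ModuleCat.{u} R, Injective N → IsZero ((T.F j).obj N)) (k : ℕ) :
    IsIso (satelliteMap T k i j h) := by
  have := isIso_cosyzygyδ T h hi hj k
  have := isIso_satelliteπ hi (k + 1)
  have := isIso_satelliteπ hj k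
  have hfac : satelliteπ (T.F i) (k + 1) ≫ satelliteMap T k i j h =
      cosyzygyδ T k i j h ≫ satelliteπ (T.F j) k := cokernel.π_desc _ _ _
  have : IsIso (satelliteπ (T.F i) (k + 1) ≫ satelliteMap T k i j h) := by
    rw [hfac]; infer_instance
  exact IsIso.of_isIso_comp_left (satelliteπ (T.F i) (k + 1)) _

/-- If the functors `T_j` vanish on injective modules, then `S^k T_{k+i}` is isomorphic to `T_i`. -/
lemma nonempty_satellite_iso
    (hT : ∀ (N : ModuleCat.{u} R), Injective N → ∀ j, IsZero ((T.F j).obj N)) (i : ℤ) (k : ℕ) :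
    Nonempty (satellite (T.F (k + i)) k ≅ T.F i) := by
  induction k with
  | zero => exact ⟨eqToIso (by simp [satellite])⟩
  | succ k ih =>
    obtain ⟨e⟩ := ih
    have := isIso_satelliteMap T (i := (k + 1 : ℕ) + i) (j := k + i) (by push_cast; ring)
      (fun N hN => hT N hN _) (fun N hN => hT N hN _) k
    exact ⟨asIso (satelliteMap T k _ _ _) ≪≫ e⟩

lemma isEventuallyConstantTo_ofOpSequence {C : Type*} [Category* C] {X : ℕ → C}
    (f : ∀ n, X (n + 1) ⟶ X n) {k : ℕ} (hf : ∀ n, k ≤ n → IsIso (f n)) :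
    (Functor.ofOpSequence f).IsEventuallyConstantTo (Opposite.op k) := by
  have key : ∀ (n : ℕ) (hn : k ≤ n),
      IsIso ((Functor.ofOpSequence f).map (homOfLE hn).op) := by
    intro n hn
    induction n, hn using Nat.le_induction with
    | base =>
      rw [show (homOfLE (le_refl k)).op = 𝟙 _ from rfl, CategoryTheory.Functor.map_id]
      infer_instance
    | succ n hn ih =>
      rw [show (homOfLE (hn.trans n.le_succ)).op =
        (homOfLE (n.le_add_right 1)).op ≫ (homOfLE hn).op from rfl, Functor.map_comp,
        Functor.ofOpSequence_map_homOfLE_succ]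
      exact @IsIso.comp_isIso _ _ _ _ _ _ _ (hf n hn) ih
  exact fun j g => key j.unop (leOfHom g.unop)

/-- If the functors `T_j` vanish on injective modules for `j` large, then the limit that defines the
J-completion is attained. -/
lemma exists_jCompletion_iso_satellite {n : ℤ}
    (hT : ∀ (N : ModuleCat.{u} R), Injective N → ∀ j, n ≤ j → IsZero ((T.F j).obj N)) (i : ℤ)
    {k : ℕ} (hk : n ≤ k + i) : Nonempty (jCompletion T i ≅ satellite (T.F (k + i)) k) := by
  have hD := isEventuallyConstantTo_ofOpSequence (X := fun k : ℕ => satellite (T.F (k + i)) k)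
    (fun k => satelliteMap T k ((k + 1 : ℕ) + i) (k + i) (by push_cast; ring)) (k := k)
    fun m hm => isIso_satelliteMap T _ (fun N hN => hT N hN _ (by push_cast; omega))
      (fun N hN => hT N hN _ (by omega)) m
  have := hD.isIso_π_of_isLimit (limit.isLimit _)
  exact ⟨@asIso _ _ _ _ _ this⟩

end Completion

end CompleteHomology

/-! ### Complete homology is Tate homology -/

theorem mainTheorem5 {𝕜 : Type w} [CommRing 𝕜] {R : Type u} [Ring R] [Algebra 𝕜 R]
    [IsNoetherianRing R] [IsNoetherianRing Rᵐᵒᵖ]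
    (M : ModuleCat.{u} Rᵐᵒᵖ) [Module.Finite Rᵐᵒᵖ M]
    (c : CompleteHomology.CompleteProjectiveResolution M) (i : ℤ) :
    Nonempty (CompleteHomology.completeHomology 𝕜 M i ≅ CompleteHomology.tateHomology 𝕜 c i) := by
  obtain ⟨n, hn⟩ := CompleteHomology.exists_tateHomology_iso_tor 𝕜 c
  have hzero := fun N hN j =>
    @CompleteHomology.tateHomology_isZero_of_injective 𝕜 _ R _ _ _ M _ c N hN j
  -- One `k` for which degree `k + i` lies in the stable range serves both to attain the limit and
  -- to exchange Tor for Tate homology.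
  obtain ⟨k, hk⟩ : ∃ k : ℕ, n ≤ k + i := ⟨(n - i).toNat, by omega⟩
  obtain ⟨e₁⟩ := CompleteHomology.exists_jCompletion_iso_satellite (CompleteHomology.tor 𝕜 M)
    (n := n) (fun N hN j hj => (hzero N hN j).of_iso ((hn j hj).some.symm.app N)) i hk
  obtain ⟨e₂⟩ := hn (k + i) hk
  obtain ⟨e₃⟩ := CompleteHomology.nonempty_satellite_iso
    (CompleteHomology.homologyTensor 𝕜 c.T c.isTotallyAcyclic.projective) hzero i k
  exact ⟨e₁ ≪≫ CompleteHomology.satelliteIso e₂.symm k ≪≫ e₃⟩
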